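/- Let $q\in\mathbb Z$ (only its class modulo $4$ matters), $m\in\mathbb Z$, $\lambda\in\mathbb R$, and let $r=-1/2$, $s=i/2$. Let $$I''(q,r,s)=\{F\in C^\infty(\mathbb R^2,\mathbb C) : F(\theta+j\pi,(-1)^jy)=i^{-jq}F(\theta,y)\ \text{ for all } j\in\mathbb Z,\ \theta,y\in\mathbb R\},$$ and let $$\Omega''=y^2\left(2i\,\partial_\theta-y^2+\partial_y^2\right),$$ which is the differential operator on $I''(q,r,s)$ by which the central element $2\Omega-r(r+2)$ acts, $\Omega=\tfrac12h^2-h+2e^+e^-$ being the Casimir element of $\mathfrak{sl}(2,\mathbb R)$. Let $K$ act by $(k_\alpha.F)(\theta,y)=F(\theta-\alpha,y)$. A function $F$ is $K$-finite if its $K$-translates span a finite-dimensional space, and it is a weight vector of weight $m$ if $F\neq0$ and $k_\alpha.F=e^{im\alpha/2}F$ for all $\alpha\in\mathbb R$, that is, $F(\theta,y)=e^{-im\theta/2}F(0,y)$. Put $$l=\tfrac12\left(1+\sqrt{1+8\lambda}\right).$$ 1. If $\lambda\neq0$, then $\ker(\Omega''-2\lambda)\subset I''(q,r,s)$ contains a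 $K$-finite vector of weight $m$ if and only if $l$ is a positive integer and $m\equiv 2l+q \pmod 4$. If $\lambda=0$, it contains a $K$-finite vector of weight $m$ if and only if $m\equiv 2l'+q\pmod 4$ for some $l'\in\{0,1\}$. 2. The number $l$ is a positive integer if and only if $\lambda=k(k-1)/2$ for a positive integer $k$, and then $l=k$. 3. If $\lambda\ne0$, $l$ is a positive integer and $m\equiv 2l+q\pmod 4$, then $$F_m(\theta,y)=e^{-im\theta/2}\,e^{-y^2/2}\,y^l\;{}_1F_1\!\left(\tfrac{1+2l-m}{4},\,l+\tfrac12,\,y^2\right)$$ is a weight vector of weight $m$ in $\ker(\Omega''-2\lambda)\subset I''(q,r,s)$, and every weight vector of weight $m$ in this kernel is a scalar multiple of $F_m$. -/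

import Mathlib

open scoped ContDiff Nat

noncomputable section

/-- The partial derivative of a function of two real variables in the first variable. -/
def dFst (f : ℝ → ℝ → ℂ) : ℝ → ℝ → ℂ := fun t x => deriv (fun t' => f t' x) t

/-- The partial derivative of a function of two real variables in the second variable. -/
def dSnd (f : ℝ → ℝ → ℂ) : ℝ → ℝ → ℂ := fun t x => deriv (fun x' => f t x') x

/-- Smooth functions on the plane. -/
def IsSmooth (f : ℝ → ℝ → ℂ) : Prop := ContDiff ℝ ∞ (Function.uncurry f)

/-- The compact picture `I''(q,r,s)`: smooth `F(θ,y)` on the plane with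
`F(θ+jπ,(-1)^j y) = i^{-jq} F(θ,y)`. The parameters `r`, `s` do not enter the space, only the
action on it; `q` is an integer representing a class modulo four. -/
def compactPicture (q : ℤ) : Set (ℝ → ℝ → ℂ) :=
  {F | IsSmooth F ∧ ∀ (j : ℤ) (θ y : ℝ),
    F (θ + j * Real.pi) ((-1 : ℝ) ^ j * y) = Complex.I ^ (-(j * q)) * F θ y}

/-- The operator `Ω'' = y² (4 s ∂_θ + 4 s² y² + ∂_y² + ((1+2r)/y) ∂_y)` at `r = -1/2`, `s = i/2`,
that is, `y² (2 i ∂_θ - y² + ∂_y²)`. The lemma `casimirNonCompact_toNonCompact` below checks that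
this is the operator by which the central element `2 Ω - r (r+2)`, with `Ω` the Casimir element
of `sl(2)`, acts in the compact picture. -/
def casimirCompact (F : ℝ → ℝ → ℂ) : ℝ → ℝ → ℂ := fun θ y =>
  (y : ℂ) ^ 2 *
    (2 * Complex.I * dFst F θ y - (y : ℂ) ^ 2 * F θ y + dSnd (dSnd F) θ y)

/-- `ker (Ω'' - 2λ)` inside the compact picture `I''(q,-1/2,i/2)`. -/
def casimirKernel (q : ℤ) (lam : ℝ) : Set (ℝ → ℝ → ℂ) :=
  {F | F ∈ compactPicture q ∧ ∀ θ y : ℝ, casimirCompact F θ y - 2 * (lam : ℂ) * F θ y = 0}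

/-- The action of the element of `K` with angle `α` on the compact picture:
`(k_α . F)(θ,y) = F(θ-α,y)`. -/
def rotate (α : ℝ) (F : ℝ → ℝ → ℂ) : ℝ → ℝ → ℂ := fun θ y => F (θ - α) y

/-- `F` is `K`-finite: its `K`-translates span a finite-dimensional space. -/
def IsKFinite (F : ℝ → ℝ → ℂ) : Prop :=
  FiniteDimensional ℂ (Submodule.span ℂ (Set.range fun α : ℝ => rotate α F))

/-- `F` is a weight vector of weight `m` for `K`: it is nonzero and `k_α . F = e^{imα/2} F`;
equivalently `F(θ,y) = e^{-imθ/2} F(0,y)`, so that `κ = i ∂_θ` acts by `m/2`. -/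
def IsWeightVector (m : ℤ) (F : ℝ → ℝ → ℂ) : Prop :=
  F ≠ 0 ∧ ∀ α θ y : ℝ, rotate α F θ y = Complex.exp (Complex.I * m * α / 2) * F θ y

/-- The confluent hypergeometric function `₁F₁(a,b,z) = ∑ (a)_n / (b)_n * z^n / n!`
(for `b` not a non-positive integer). -/
def hyp1F1 (a b z : ℂ) : ℂ :=
  ∑' n : ℕ, (ascPochhammer ℂ n).eval a / (ascPochhammer ℂ n).eval b * (z ^ n / (n ! : ℂ))

/-- `e^{-imθ/2} e^{-y²/2} y^l ₁F₁((1+2l-m)/4, l+1/2, y²)`. -/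
def kTypeVector (m : ℤ) (l : ℕ) : ℝ → ℝ → ℂ := fun θ y =>
  Complex.exp (-(Complex.I * m * θ / 2)) * Complex.exp (-((y : ℂ) ^ 2 / 2)) * (y : ℂ) ^ l *
    hyp1F1 ((1 + 2 * (l : ℂ) - m) / 4) ((l : ℂ) + 1 / 2) ((y : ℂ) ^ 2)

section NonCompact

/-- The element `h` of the standard triple in the non-compact picture, for `r = -1/2`:
`-x ∂_x - 2 t ∂_t + r`. -/
def hNonCompact (f : ℝ → ℝ → ℂ) : ℝ → ℝ → ℂ := fun t x =>
  -(x : ℂ) * dSnd f t x - 2 * (t : ℂ) * dFst f t x + (-1 / 2) * f t x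

/-- The element `e⁺` in the non-compact picture: `-∂_t`. -/
def ePlusNonCompact (f : ℝ → ℝ → ℂ) : ℝ → ℝ → ℂ := fun t x => -dFst f t x

/-- The element `e⁻` in the non-compact picture, for `r = -1/2`, `s = i/2`:
`t x ∂_x + t² ∂_t - (s x² + r t)`. -/
def eMinusNonCompact (f : ℝ → ℝ → ℂ) : ℝ → ℝ → ℂ := fun t x =>
  (t : ℂ) * x * dSnd f t x + (t : ℂ) ^ 2 * dFst f t x
    - (Complex.I / 2 * (x : ℂ) ^ 2 + (-1 / 2) * t) * f t x

/-- `Ω' = 2 Ω - r (r+2)` with `Ω = h²/2 - h + 2 e⁺ e⁻`, in the non-compact picture, for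
`r = -1/2`, `s = i/2`. -/
def casimirNonCompact (f : ℝ → ℝ → ℂ) : ℝ → ℝ → ℂ := fun t x =>
  2 * (1 / 2 * hNonCompact (hNonCompact f) t x - hNonCompact f t x
    + 2 * ePlusNonCompact (eMinusNonCompact f) t x) - (-1 / 2) * (-1 / 2 + 2) * f t x

/-- The passage from the compact to the non-compact picture, for `r = -1/2`, `s = i/2`:
`f(t,x) = (1+t²)^{r/2} e^{s t x²/(1+t²)} F(arctan t, x (1+t²)^{-1/2})`. -/
def toNonCompact (F : ℝ → ℝ → ℂ) : ℝ → ℝ → ℂ := fun t x =>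
  (((1 + t ^ 2) ^ (-1 / 4 : ℝ) : ℝ) : ℂ)
    * Complex.exp (Complex.I / 2 * (t * (x : ℂ) ^ 2 / (1 + (t : ℂ) ^ 2)))
    * F (Real.arctan t) (x * (1 + t ^ 2) ^ (-1 / 2 : ℝ))

theorem IsSmooth.hasDerivAt_fst {f : ℝ → ℝ → ℂ} (hf : IsSmooth f) (t x : ℝ) :
    HasDerivAt (fun t' => f t' x) (fderiv ℝ (Function.uncurry f) (t, x) (1, 0)) t := by
  have h1 : HasFDerivAt (Function.uncurry f) (fderiv ℝ (Function.uncurry f) (t, x)) (t, x) :=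
    (hf.differentiable (by simp) (t, x)).hasFDerivAt
  have h2 : HasDerivAt (fun t' : ℝ => (t', x)) ((1 : ℝ), (0 : ℝ)) t :=
    (hasDerivAt_id t).prodMk (hasDerivAt_const t x)
  exact h1.comp_hasDerivAt t h2

theorem IsSmooth.hasDerivAt_snd {f : ℝ → ℝ → ℂ} (hf : IsSmooth f) (t x : ℝ) :
    HasDerivAt (fun x' => f t x') (fderiv ℝ (Function.uncurry f) (t, x) (0, 1)) x := by
  have h1 : HasFDerivAt (Function.uncurry f) (fderiv ℝ (Function.uncurry f) (t, x)) (t, x) :=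
    (hf.differentiable (by simp) (t, x)).hasFDerivAt
  have h2 : HasDerivAt (fun x' : ℝ => (t, x')) ((0 : ℝ), (1 : ℝ)) x :=
    (hasDerivAt_const x t).prodMk (hasDerivAt_id x)
  exact h1.comp_hasDerivAt x h2

theorem IsSmooth.hd1 {f : ℝ → ℝ → ℂ} (hf : IsSmooth f) (t x : ℝ) :
    HasDerivAt (fun t' => f t' x) (dFst f t x) t :=
  (hf.hasDerivAt_fst t x).differentiableAt.hasDerivAt

theorem IsSmooth.hd2 {f : ℝ → ℝ → ℂ} (hf : IsSmooth f) (t x : ℝ) :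
    HasDerivAt (fun x' => f t x') (dSnd f t x) x :=
  (hf.hasDerivAt_snd t x).differentiableAt.hasDerivAt

theorem IsSmooth.uncurry_dFst {f : ℝ → ℝ → ℂ} (hf : IsSmooth f) :
    Function.uncurry (dFst f) = fun p => fderiv ℝ (Function.uncurry f) p (1, 0) := by
  funext ⟨t, x⟩
  exact (hf.hasDerivAt_fst t x).deriv

theorem IsSmooth.uncurry_dSnd {f : ℝ → ℝ → ℂ} (hf : IsSmooth f) :
    Function.uncurry (dSnd f) = fun p => fderiv ℝ (Function.uncurry f) p (0, 1) := by
  funext ⟨t, x⟩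
  exact (hf.hasDerivAt_snd t x).deriv

theorem IsSmooth.dFst {f : ℝ → ℝ → ℂ} (hf : IsSmooth f) : IsSmooth (dFst f) := by
  unfold IsSmooth
  rw [hf.uncurry_dFst]
  exact (ContDiff.fderiv_right (m := ∞) hf (by simp)).clm_apply contDiff_const

theorem IsSmooth.dSnd {f : ℝ → ℝ → ℂ} (hf : IsSmooth f) : IsSmooth (dSnd f) := by
  unfold IsSmooth
  rw [hf.uncurry_dSnd]
  exact (ContDiff.fderiv_right (m := ∞) hf (by simp)).clm_apply contDiff_const

theorem IsSmooth.dFst_dSnd {f : ℝ → ℝ → ℂ} (hf : IsSmooth f) (t x : ℝ) :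
    _root_.dFst (_root_.dSnd f) t x = _root_.dSnd (_root_.dFst f) t x := by
  have h1 := (hf.dSnd.hasDerivAt_fst t x).deriv
  have h2 := (hf.dFst.hasDerivAt_snd t x).deriv
  rw [hf.uncurry_dSnd] at h1
  rw [hf.uncurry_dFst] at h2
  have hd : DifferentiableAt ℝ (fderiv ℝ (Function.uncurry f)) (t, x) :=
    (ContDiff.fderiv_right (m := ∞) hf (by simp)).differentiable (by simp) _
  rw [fderiv_clm_apply hd (by fun_prop)] at h1 h2
  have hs : IsSymmSndFDerivAt ℝ (Function.uncurry f) (t, x) :=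
    (ContDiff.contDiffAt hf).isSymmSndFDerivAt (by
      rw [minSmoothness_of_isRCLikeNormedField]
      exact WithTop.coe_le_coe.2 (le_top : (2 : ℕ∞) ≤ ⊤))
  simp at h1 h2
  calc _ = _ := h1
    _ = _ := hs _ _
    _ = _ := h2.symm

theorem casimirNonCompact_eq {f : ℝ → ℝ → ℂ} (hf : IsSmooth f) (t x : ℝ) :
    casimirNonCompact f t x
      = (x : ℂ) ^ 2 * (2 * Complex.I * dFst f t x + dSnd (dSnd f) t x) := by
  have ct : HasDerivAt (fun t' : ℝ => (t' : ℂ)) 1 t := Complex.ofRealCLM.hasDerivAt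
  have cx : HasDerivAt (fun x' : ℝ => (x' : ℂ)) 1 x := Complex.ofRealCLM.hasDerivAt
  have e1 : dFst (hNonCompact f) t x = _ :=
    (((((hf.dSnd.hd1 t x).const_mul (-(x : ℂ))).sub ((ct.const_mul 2).mul (hf.dFst.hd1 t x))).add
      ((hf.hd1 t x).const_mul (-1 / 2 : ℂ)))).deriv
  have e2 : dSnd (hNonCompact f) t x = _ :=
    (((cx.neg.mul (hf.dSnd.hd2 t x)).sub ((hf.dFst.hd2 t x).const_mul (2 * (t : ℂ)))).add
      ((hf.hd2 t x).const_mul (-1 / 2 : ℂ))).deriv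
  have e3 : dFst (eMinusNonCompact f) t x = _ :=
    ((((ct.mul_const (x : ℂ)).mul (hf.dSnd.hd1 t x)).add ((ct.pow 2).mul (hf.dFst.hd1 t x))).sub
      (((ct.const_mul (-1 / 2 : ℂ)).const_add (Complex.I / 2 * (x : ℂ) ^ 2)).mul
        (hf.hd1 t x))).deriv
  unfold casimirNonCompact
  rw [hNonCompact, e1, e2, ePlusNonCompact, e3, hf.dFst_dSnd t x]
  simp only [hNonCompact]
  push_cast
  simp only [Pi.neg_apply, Pi.pow_apply]
  ring

theorem IsSmooth.toNonCompact {F : ℝ → ℝ → ℂ} (hF : IsSmooth F) : IsSmooth (toNonCompact F) := by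
  have hpos : ∀ p : ℝ × ℝ, (1 + p.1 ^ 2 : ℝ) ≠ 0 := fun p => by positivity
  have hposc : ∀ p : ℝ × ℝ, (1 + (p.1 : ℂ) ^ 2 : ℂ) ≠ 0 := fun p => mod_cast hpos p
  have hb : ContDiff ℝ ∞ (fun p : ℝ × ℝ => 1 + p.1 ^ 2) := by fun_prop
  have c1 : ContDiff ℝ ∞ (fun p : ℝ × ℝ => (p.1 : ℂ)) := Complex.ofRealCLM.contDiff.comp contDiff_fst
  have c2 : ContDiff ℝ ∞ (fun p : ℝ × ℝ => (p.2 : ℂ)) := Complex.ofRealCLM.contDiff.comp contDiff_snd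
  have hA : ContDiff ℝ ∞ (fun p : ℝ × ℝ => (((1 + p.1 ^ 2) ^ (-1 / 4 : ℝ) : ℝ) : ℂ)) :=
    Complex.ofRealCLM.contDiff.comp (hb.rpow_const_of_ne hpos)
  have hE : ContDiff ℝ ∞ (fun p : ℝ × ℝ =>
      Complex.exp (Complex.I / 2 * (p.1 * (p.2 : ℂ) ^ 2 / (1 + (p.1 : ℂ) ^ 2)))) :=
    (contDiff_const.mul ((c1.mul (c2.pow 2)).mul (ContDiff.inv (contDiff_const.add (c1.pow 2)) hposc))).cexp
  have hG : ContDiff ℝ ∞ (fun p : ℝ × ℝ =>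
      (Real.arctan p.1, p.2 * (1 + p.1 ^ 2) ^ (-1 / 2 : ℝ))) :=
    contDiff_fst.arctan.prodMk (contDiff_snd.mul (hb.rpow_const_of_ne hpos))
  exact (hA.mul hE).mul (ContDiff.comp hF hG)

theorem casimirNonCompact_toNonCompact {F : ℝ → ℝ → ℂ} (hF : IsSmooth F) :
    casimirNonCompact (toNonCompact F) = toNonCompact (casimirCompact F) := by
  funext t x
  rw [casimirNonCompact_eq hF.toNonCompact]
  have hpos : (0 : ℝ) < 1 + t ^ 2 := by positivity
  have hposc : (1 + (t : ℂ) ^ 2 : ℂ) ≠ 0 := mod_cast hpos.ne'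
  have ct : HasDerivAt (fun t' : ℝ => (t' : ℂ)) 1 t := Complex.ofRealCLM.hasDerivAt
  have cx : ∀ x : ℝ, HasDerivAt (fun x' : ℝ => (x' : ℂ)) 1 x :=
    fun x => Complex.ofRealCLM.hasDerivAt
  have hb : HasDerivAt (fun t' : ℝ => 1 + t' ^ 2) (2 * t) t := by
    simpa using (hasDerivAt_pow 2 t).const_add 1
  set c : ℝ := (1 + t ^ 2) ^ (-1 / 2 : ℝ) with hc
  set a : ℝ := (1 + t ^ 2) ^ (-1 / 4 : ℝ) with ha
  have hc2 : (c : ℂ) ^ 2 = (1 + (t : ℂ) ^ 2)⁻¹ := by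
    have : c ^ 2 = (1 + t ^ 2)⁻¹ := by
      rw [hc, ← Real.rpow_natCast, ← Real.rpow_mul hpos.le, ← Real.rpow_neg_one]
      norm_num
    exact mod_cast this
  have hcd : HasDerivAt (fun t' : ℝ => (1 + t' ^ 2) ^ (-1 / 2 : ℝ)) (-t * c / (1 + t ^ 2)) t := by
    convert hb.rpow_const (p := (-1 / 2 : ℝ)) (Or.inl hpos.ne') using 1
    rw [Real.rpow_sub_one hpos.ne', ← hc]
    ring
  have had : HasDerivAt (fun t' : ℝ => (1 + t' ^ 2) ^ (-1 / 4 : ℝ))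
      (-t * a / (2 * (1 + t ^ 2))) t := by
    convert hb.rpow_const (p := (-1 / 4 : ℝ)) (Or.inl hpos.ne') using 1
    rw [Real.rpow_sub_one hpos.ne', ← ha]
    field_simp
    ring
  have hadc := had.ofReal_comp
  have hEt : HasDerivAt (fun t' : ℝ =>
      Complex.exp (Complex.I / 2 * (t' * (x : ℂ) ^ 2 / (1 + (t' : ℂ) ^ 2))))
      (Complex.exp (Complex.I / 2 * (t * (x : ℂ) ^ 2 / (1 + (t : ℂ) ^ 2))) *
        (Complex.I / 2 * ((x : ℂ) ^ 2 * (1 - (t : ℂ) ^ 2) / (1 + (t : ℂ) ^ 2) ^ 2))) t := by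
    refine ((((ct.mul_const ((x : ℂ) ^ 2)).div ((ct.pow 2).const_add 1) hposc).const_mul
      (Complex.I / 2)).cexp).congr_deriv ?_
    simp only [Pi.div_apply, Pi.pow_apply]
    congr 3
    push_cast
    ring
  have hEx : ∀ x : ℝ, HasDerivAt (fun x' : ℝ =>
      Complex.exp (Complex.I / 2 * (t * (x' : ℂ) ^ 2 / (1 + (t : ℂ) ^ 2))))
      (Complex.exp (Complex.I / 2 * (t * (x : ℂ) ^ 2 / (1 + (t : ℂ) ^ 2))) *
        (Complex.I * t * x / (1 + (t : ℂ) ^ 2))) x := by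
    intro x
    refine (((((cx x).pow 2).const_mul (t : ℂ)).div_const (1 + (t : ℂ) ^ 2)).const_mul
      (Complex.I / 2) |>.cexp).congr_deriv ?_
    simp only [Pi.pow_apply]
    congr 1
    push_cast
    ring
  have hsub : ∀ {G : ℝ → ℝ → ℂ}, IsSmooth G → ∀ x : ℝ,
      HasDerivAt (fun x' : ℝ => G (Real.arctan t) (x' * c))
        (c * dSnd G (Real.arctan t) (x * c)) x := by
    intro G hG x
    have h := (hG.hd2 (Real.arctan t) (x * c)).scomp x ((hasDerivAt_id x).mul_const c)
    exact h.congr_deriv (by simp)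
  have hFt : HasDerivAt (fun t' : ℝ => F (Real.arctan t') (x * (1 + t' ^ 2) ^ (-1 / 2 : ℝ)))
      ((1 / (1 + t ^ 2) : ℝ) * dFst F (Real.arctan t) (x * c)
        + (x * (-t * c / (1 + t ^ 2)) : ℝ) * dSnd F (Real.arctan t) (x * c)) t := by
    have h1 : HasFDerivAt (Function.uncurry F) _ (Real.arctan t, x * c) :=
      (hF.differentiable (by simp) (Real.arctan t, x * c)).hasFDerivAt
    have h2 := (Real.hasDerivAt_arctan t).prodMk (hcd.const_mul x)
    have h3 := h1.comp_hasDerivAt t h2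
    have e1 : dFst F (Real.arctan t) (x * c) = _ :=
      (hF.hasDerivAt_fst (Real.arctan t) (x * c)).deriv
    have e2 : dSnd F (Real.arctan t) (x * c) = _ :=
      (hF.hasDerivAt_snd (Real.arctan t) (x * c)).deriv
    refine h3.congr_deriv ?_
    rw [show ((1 / (1 + t ^ 2), x * (-t * c / (1 + t ^ 2))) : ℝ × ℝ)
      = (1 / (1 + t ^ 2) : ℝ) • ((1 : ℝ), (0 : ℝ))
        + (x * (-t * c / (1 + t ^ 2)) : ℝ) • ((0 : ℝ), (1 : ℝ)) by simp,
      map_add, map_smul, map_smul, ← e1, ← e2, Complex.real_smul, Complex.real_smul]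
  have dt : dFst (toNonCompact F) t x = _ := ((hadc.mul hEt).mul hFt).deriv
  have dx : dSnd (toNonCompact F) t = _ := funext fun x =>
    (((hEx x).const_mul (a : ℂ)).mul (hsub hF x)).deriv
  have dxx := (congrArg (fun g : ℝ → ℂ => deriv g x) dx).trans
    (((((hEx x).mul (((cx x).const_mul (Complex.I * t)).div_const
      (1 + (t : ℂ) ^ 2))).const_mul (a : ℂ)).mul (hsub hF x)).add
        (((hEx x).const_mul (a : ℂ)).mul ((hsub hF.dSnd x).const_mul (c : ℂ)))).deriv
  change dSnd (dSnd (toNonCompact F)) t x = _ at dxx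
  rw [dt, dxx]
  simp only [toNonCompact, casimirCompact, Pi.mul_apply, ← hc, ← ha]
  push_cast
  generalize Complex.exp (Complex.I / 2 * (t * (x : ℂ) ^ 2 / (1 + (t : ℂ) ^ 2))) = E
  generalize dSnd (dSnd F) (Real.arctan t) (x * c) = Fyy
  generalize dSnd F (Real.arctan t) (x * c) = Fy
  generalize dFst F (Real.arctan t) (x * c) = Ft
  generalize F (Real.arctan t) (x * c) = F0
  have hT : (1 + (t : ℂ) ^ 2)⁻¹ = (c : ℂ) ^ 2 := hc2.symm
  simp only [div_eq_mul_inv, mul_inv, one_mul, ← inv_pow, hT]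
  linear_combination (x : ℂ) ^ 4 * (c : ℂ) ^ 4 * a * E * F0 * Complex.I_sq

end NonCompact

end

/-! A weight vector is determined by its restriction `w` to `θ = 0`. Membership in the kernel then
means that `w` is a smooth solution of `y² w'' = (2λ + y⁴ - m y²) w` on the whole line and that
`w(-y) = i^(m-q) w(y)`. This equation has a regular singular point at the origin, with indicial
equation `n(n-1) = 2λ`.

Necessity: comparing Taylor coefficients at the origin shows that the first nonzero one has an index
`n` satisfying the indicial equation (`RadialSolution.exists_indicial`). A nonzero solution has such
a coefficient because a flat solution vanishes, by an energy estimate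
(`RadialSolution.eq_zero_of_flat`). The symmetry of `w` gives `(-1)^n = i^(m-q)`, which is the
congruence modulo 4.

Sufficiency: for every natural root `l`, zero included, Kummer's equation makes the explicit
function a smooth solution of parity `(-1)^l` (`radialSolution_kTypeRadial`).

Uniqueness: for `λ ≠ 0` the indicial equation has at most one root in `ℕ`, so subtracting a suitable
multiple of one nonzero solution from another solution removes the only possible leading coefficient
(`RadialSolution.exists_eq_smul`). For `λ = 0` both 0 and 1 are roots. -/

/-- Smooth solutions of the radial equation `y² w'' = (2λ + y⁴ - m y²) w` on the line. -/
def RadialSolution (m : ℤ) (lam : ℝ) (w : ℝ → ℂ) : Prop :=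
  ContDiff ℝ ∞ w ∧ ∀ y : ℝ,
    (y : ℂ) ^ 2 * deriv (deriv w) y = (2 * (lam : ℂ) + (y : ℂ) ^ 4 - m * (y : ℂ) ^ 2) * w y

theorem contDiff_infty_deriv {g : ℝ → ℂ} (hg : ContDiff ℝ ∞ g) : ContDiff ℝ ∞ (deriv g) :=
  (contDiff_infty_iff_deriv.1 hg).2

theorem contDiff_infty_differentiable {g : ℝ → ℂ} (hg : ContDiff ℝ ∞ g) : Differentiable ℝ g :=
  (contDiff_infty_iff_deriv.1 hg).1

theorem contDiff_infty_ofReal : ContDiff ℝ ∞ (fun y : ℝ => (y : ℂ)) :=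
  Complex.ofRealCLM.contDiff

theorem hasDerivAt_ofReal (y : ℝ) : HasDerivAt (fun x : ℝ => (x : ℂ)) 1 y :=
  Complex.ofRealCLM.hasDerivAt

/-! ### Taylor coefficients at the origin. -/

/-- The derivatives at the origin of `y g(y)`. -/
theorem iteratedDeriv_succ_ofReal_mul_zero (n : ℕ) :
    ∀ {g : ℝ → ℂ}, ContDiff ℝ ∞ g →
      iteratedDeriv (n + 1) (fun y : ℝ => (y : ℂ) * g y) 0 = (n + 1) * iteratedDeriv n g 0 := by
  induction n with
  | zero =>
    intro g hg
    have h := (hasDerivAt_ofReal 0).mul (contDiff_infty_differentiable hg 0).hasDerivAt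
    rw [iteratedDeriv_one]
    exact h.deriv.trans (by simp)
  | succ n ih =>
    intro g hg
    -- One derivative leaves `g + y g'`, so the induction hypothesis is needed for `g'`; hence `g`
    -- is quantified inside the induction.
    have hd : deriv (fun y : ℝ => (y : ℂ) * g y) = fun y : ℝ => g y + (y : ℂ) * deriv g y := by
      funext y
      exact ((hasDerivAt_ofReal y).mul
        (contDiff_infty_differentiable hg y).hasDerivAt).deriv.trans (by simp)
    have hg' := contDiff_infty_deriv hg
    have hle : ((n + 1 : ℕ) : WithTop ℕ∞) ≤ ∞ := by exact_mod_cast le_top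
    rw [iteratedDeriv_succ', hd, iteratedDeriv_fun_add (hg.of_le hle).contDiffAt
      ((contDiff_infty_ofReal.mul hg').of_le hle).contDiffAt, ih hg', ← iteratedDeriv_succ']
    push_cast
    ring

/-- The derivatives at the origin of `y² g(y)`. -/
theorem iteratedDeriv_add_two_ofReal_sq_mul_zero (n : ℕ) {g : ℝ → ℂ} (hg : ContDiff ℝ ∞ g) :
    iteratedDeriv (n + 2) (fun y : ℝ => (y : ℂ) ^ 2 * g y) 0
      = (n + 2) * (n + 1) * iteratedDeriv n g 0 := by
  have h : (fun y : ℝ => (y : ℂ) ^ 2 * g y) = fun y : ℝ => (y : ℂ) * ((y : ℂ) * g y) := by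
    funext y; ring
  rw [h, iteratedDeriv_succ_ofReal_mul_zero (n + 1) (contDiff_infty_ofReal.mul hg),
    iteratedDeriv_succ_ofReal_mul_zero n hg]
  push_cast
  ring

theorem iteratedDeriv_one_ofReal_sq_mul_zero {g : ℝ → ℂ} (hg : ContDiff ℝ ∞ g) :
    iteratedDeriv 1 (fun y : ℝ => (y : ℂ) ^ 2 * g y) 0 = 0 := by
  have h : (fun y : ℝ => (y : ℂ) ^ 2 * g y) = fun y : ℝ => (y : ℂ) * ((y : ℂ) * g y) := by
    funext y; ring
  rw [h, iteratedDeriv_succ_ofReal_mul_zero 0 (contDiff_infty_ofReal.mul hg)]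
  simp

/-! ### Flat solutions vanish. -/

/-- A smooth function that is flat at the origin is bounded by every power. -/
theorem exists_norm_le_pow_of_flat (R : ℝ) (N : ℕ) :
    ∀ {g : ℝ → ℂ}, ContDiff ℝ ∞ g → (∀ n, iteratedDeriv n g 0 = 0) →
      ∃ C : ℝ, 0 ≤ C ∧ ∀ y ∈ Set.Icc 0 R, ‖g y‖ ≤ C * y ^ N := by
  induction N with
  | zero =>
    intro g hg _
    obtain ⟨C, hC⟩ := (isCompact_Icc (a := (0 : ℝ)) (b := R)).exists_bound_of_continuousOn
      hg.continuous.continuousOn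
    exact ⟨max C 0, le_max_right _ _, fun y hy => by simpa using Or.inl (hC y hy)⟩
  | succ N ih =>
    intro g hg h0
    obtain ⟨C, hC0, hC⟩ := ih (contDiff_infty_deriv hg) fun n => by
      rw [← iteratedDeriv_succ']; exact h0 _
    refine ⟨C, hC0, fun y hy => ?_⟩
    -- Mean value inequality on `[0, y]`: the bound `C y^N` on the derivative gains one factor `y`.
    have h := (convex_Icc (0 : ℝ) y).norm_image_sub_le_of_norm_deriv_le (f := g)
      (C := C * y ^ N) (fun x _ => contDiff_infty_differentiable hg x)
      (fun x hx => (hC x ⟨hx.1, hx.2.trans hy.2⟩).trans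
        (mul_le_mul_of_nonneg_left (pow_le_pow_left₀ hx.1 hx.2 N) hC0))
      (Set.left_mem_Icc.2 hy.1) (Set.right_mem_Icc.2 hy.1)
    have hg0 : g 0 = 0 := by simpa using h0 0
    rw [hg0, sub_zero, sub_zero, Real.norm_of_nonneg hy.1] at h
    rw [pow_succ, ← mul_assoc]
    exact h

/-- A nonnegative function with `y E' ≤ N E` on `(0, R]` and `E = O(y^(N+1))` vanishes. -/
theorem eq_zero_of_mul_deriv_le {E E' : ℝ → ℝ} {R C : ℝ} {N : ℕ} (hE0 : ∀ y, 0 ≤ E y)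
    (hE : ∀ y, HasDerivAt E (E' y) y)
    (hle : ∀ y ∈ Set.Ioc 0 R, y * E' y ≤ N * E y)
    (hC : ∀ y ∈ Set.Ioc 0 R, E y ≤ C * y ^ (N + 1)) {y : ℝ} (hy : y ∈ Set.Ioc 0 R) :
    E y = 0 := by
  have hd : ∀ x : ℝ, 0 < x → HasDerivAt (fun x => E x / x ^ N)
      ((E' x * x ^ N - E x * (N * x ^ (N - 1))) / (x ^ N) ^ 2) x := fun x hx =>
    (hE x).div (hasDerivAt_pow N x) (pow_pos hx N).ne'
  -- The differential inequality makes `E / x^N` nonincreasing, so its value at `y` is at most its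
  -- value at `ε`, which is `O(ε)`; then `ε` tends to 0.
  have key : ∀ ε ∈ Set.Ioo 0 y, E y / y ^ N ≤ C * ε := by
    intro ε hε
    have hanti : AntitoneOn (fun x => E x / x ^ N) (Set.Icc ε y) := by
      refine antitoneOn_of_deriv_nonpos (convex_Icc _ _)
        (fun x hx => (hd x (hε.1.trans_le hx.1)).continuousAt.continuousWithinAt)
        (fun x hx => ?_) (fun x hx => ?_)
      · rw [interior_Icc] at hx
        exact (hd x (hε.1.trans hx.1)).differentiableAt.differentiableWithinAt
      · rw [interior_Icc] at hx
        have hx0 : 0 < x := hε.1.trans hx.1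
        rw [(hd x hx0).deriv]
        refine div_nonpos_of_nonpos_of_nonneg ?_ (sq_nonneg _)
        have h1 := hle x ⟨hx0, hx.2.le.trans hy.2⟩
        have h2 : x * (N * x ^ (N - 1)) = N * x ^ N := by
          rcases N with _ | N
          · simp
          · simp [pow_succ]; ring
        have h3 := mul_le_mul_of_nonneg_right h1 (pow_pos hx0 N).le
        have h4 : x * (E' x * x ^ N - E x * (N * x ^ (N - 1))) ≤ 0 := by
          rw [mul_sub, mul_left_comm x (E x), h2]
          linarith
        exact nonpos_of_mul_nonpos_right h4 hx0
    have h1 := hanti (Set.left_mem_Icc.2 hε.2.le) (Set.right_mem_Icc.2 hε.2.le) hε.2.le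
    refine h1.trans ?_
    rw [div_le_iff₀ (pow_pos hε.1 N), mul_assoc, ← pow_succ']
    exact hC ε ⟨hε.1, hε.2.le.trans hy.2⟩
  have h1 : E y / y ^ N ≤ C * 0 := by
    refine ge_of_tendsto (x := nhdsWithin (0 : ℝ) (Set.Ioi 0)) (f := fun ε => C * ε)
      (((continuous_const.mul continuous_id).tendsto 0).mono_left nhdsWithin_le_nhds) ?_
    filter_upwards [Ioo_mem_nhdsGT hy.1] with ε hε using key ε hε
  have h2 : E y ≤ 0 := by
    rw [mul_zero, div_le_iff₀ (pow_pos hy.1 N), zero_mul] at h1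
    exact h1
  exact le_antisymm h2 (hE0 y)

/-- A flat smooth solution of the radial equation vanishes on the positive half line. -/
theorem RadialSolution.eq_zero_of_flat_of_pos {m : ℤ} {lam : ℝ} {w : ℝ → ℂ}
    (h : RadialSolution m lam w) (h0 : ∀ n, iteratedDeriv n w 0 = 0) {y : ℝ} (hy : 0 < y) :
    w y = 0 := by
  have hs := h.1
  have hs' := contDiff_infty_deriv hs
  obtain ⟨M, hM⟩ := (isCompact_Icc (a := (0 : ℝ)) (b := y)).exists_bound_of_continuousOn
    (f := fun x : ℝ => 2 * (lam : ℂ) + (x : ℂ) ^ 4 - m * (x : ℂ) ^ 2)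
    (by fun_prop)
  -- With `p = x w'`, `V` the coefficient of `w`, `|V| ≤ M` and `E = |w|² + |p|²`, one has `x E' =
  -- 2⟨w,p⟩ + 2|p|² + 2⟨p,Vw⟩`. The three terms are at most `E`, `2E` and `M E`, whence `3 + M`.
  obtain ⟨N, hN⟩ := exists_nat_ge (3 + M)
  set p : ℝ → ℂ := fun x => (x : ℂ) * deriv w x with hp
  have hdw : ∀ x, HasDerivAt w (deriv w x) x := fun x =>
    (contDiff_infty_differentiable hs x).hasDerivAt
  have hdp : ∀ x : ℝ, HasDerivAt p (deriv w x + x * deriv (deriv w) x) x := fun x => by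
    refine ((hasDerivAt_ofReal x).mul
      (contDiff_infty_differentiable hs' x).hasDerivAt).congr_deriv (by simp)
  obtain ⟨C₁, hC₁0, hC₁⟩ := exists_norm_le_pow_of_flat y (N + 1) hs h0
  obtain ⟨C₂, hC₂0, hC₂⟩ := exists_norm_le_pow_of_flat y (N + 1) hs' fun n => by
    rw [← iteratedDeriv_succ']; exact h0 _
  have hE := eq_zero_of_mul_deriv_le (E := fun x => ‖w x‖ ^ 2 + ‖p x‖ ^ 2) (R := y) (N := N)
    (C := C₁ ^ 2 * y ^ (N + 1) + C₂ ^ 2 * y ^ (N + 3))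
    (fun x => by positivity) (fun x => (hdw x).norm_sq.add (hdp x).norm_sq)
    (fun x hx => ?_) (fun x hx => ?_) (Set.right_mem_Ioc.2 hy)
  · have : ‖w y‖ ^ 2 = 0 := by
      have := sq_nonneg ‖w y‖
      have := sq_nonneg ‖p y‖
      linarith
    simpa using this
  · have e1 : x * inner ℝ (w x) (deriv w x) = inner ℝ (w x) (p x) := by
      rw [← real_inner_smul_right, hp, Complex.real_smul]
    -- The equation enters here, as `x p' = p + x² w'' = p + V w`.
    have e2 : x * inner ℝ (p x) (deriv w x + x * deriv (deriv w) x)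
        = ‖p x‖ ^ 2
          + inner ℝ (p x) ((2 * (lam : ℂ) + (x : ℂ) ^ 4 - m * (x : ℂ) ^ 2) * w x) := by
      rw [← real_inner_smul_right, ← h.2 x, ← real_inner_self_eq_norm_sq, ← inner_add_right,
        Complex.real_smul]
      congr 1
      simp only [hp]
      ring
    have b1 := real_inner_le_norm (w x) (p x)
    have b2 := real_inner_le_norm (p x)
      ((2 * (lam : ℂ) + (x : ℂ) ^ 4 - m * (x : ℂ) ^ 2) * w x)
    rw [norm_mul (2 * (lam : ℂ) + (x : ℂ) ^ 4 - m * (x : ℂ) ^ 2)] at b2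
    have b3 := hM x ⟨hx.1.le, hx.2⟩
    have hM0 : 0 ≤ M := (norm_nonneg _).trans b3
    have b4 : ‖p x‖ * (‖2 * (lam : ℂ) + (x : ℂ) ^ 4 - m * (x : ℂ) ^ 2‖ * ‖w x‖)
        ≤ M * (‖w x‖ * ‖p x‖) := by
      have := mul_le_mul_of_nonneg_right b3 (mul_nonneg (norm_nonneg (w x)) (norm_nonneg (p x)))
      linarith
    have b5 : 2 * (‖w x‖ * ‖p x‖) ≤ ‖w x‖ ^ 2 + ‖p x‖ ^ 2 := by
      linarith [sq_nonneg (‖w x‖ - ‖p x‖)]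
    have b6 := mul_le_mul_of_nonneg_left b5 hM0
    have b7 := mul_le_mul_of_nonneg_right hN
      (add_nonneg (sq_nonneg ‖w x‖) (sq_nonneg ‖p x‖))
    have b8 := sq_nonneg ‖w x‖
    rw [mul_add, mul_left_comm x 2, mul_left_comm x 2, e1, e2]
    linarith
  · have c1 := hC₁ x ⟨hx.1.le, hx.2⟩
    have c2 := hC₂ x ⟨hx.1.le, hx.2⟩
    have hx0 := hx.1.le
    have d1 : ‖w x‖ ^ 2 ≤ C₁ ^ 2 * y ^ (N + 1) * x ^ (N + 1) := by
      calc ‖w x‖ ^ 2 ≤ (C₁ * x ^ (N + 1)) ^ 2 := pow_le_pow_left₀ (norm_nonneg _) c1 2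
        _ = C₁ ^ 2 * x ^ (N + 1) * x ^ (N + 1) := by ring
        _ ≤ _ := by gcongr; exact hx.2
    have d2 : ‖p x‖ ^ 2 ≤ C₂ ^ 2 * y ^ (N + 3) * x ^ (N + 1) := by
      have : ‖p x‖ ≤ x * (C₂ * x ^ (N + 1)) := by
        rw [hp, norm_mul, Complex.norm_real, Real.norm_of_nonneg hx0]
        gcongr
      calc ‖p x‖ ^ 2 ≤ (x * (C₂ * x ^ (N + 1))) ^ 2 := pow_le_pow_left₀ (norm_nonneg _) this 2
        _ = C₂ ^ 2 * x ^ (N + 3) * x ^ (N + 1) := by ring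
        _ ≤ _ := by gcongr; exact hx.2
    linarith

/-- Only even powers of `y` occur in the equation. This transfers the vanishing result from the
positive to the negative half line. -/
theorem RadialSolution.comp_neg {m : ℤ} {lam : ℝ} {w : ℝ → ℂ} (h : RadialSolution m lam w) :
    RadialSolution m lam fun y => w (-y) := by
  refine ⟨h.1.comp contDiff_neg, fun y => ?_⟩
  have e1 : deriv (fun y => w (-y)) = fun y => -deriv w (-y) := by
    funext y; exact deriv_comp_neg w y
  have e2 : deriv (fun y => -deriv w (-y)) y = deriv (deriv w) (-y) := by
    rw [deriv.fun_neg, deriv_comp_neg (deriv w) y, neg_neg]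
  rw [e1, e2]
  have := h.2 (-y)
  push_cast at this
  linear_combination this

/-- A flat smooth solution of the radial equation vanishes. -/
theorem RadialSolution.eq_zero_of_flat {m : ℤ} {lam : ℝ} {w : ℝ → ℂ}
    (h : RadialSolution m lam w) (h0 : ∀ n, iteratedDeriv n w 0 = 0) : w = 0 := by
  funext y
  rcases lt_trichotomy y 0 with hy | rfl | hy
  · have := h.comp_neg.eq_zero_of_flat_of_pos (y := -y)
      (fun n => by rw [iteratedDeriv_comp_neg, neg_zero, h0, smul_zero]) (by linarith)
    simpa using this
  · simpa using h0 0
  · exact h.eq_zero_of_flat_of_pos h0 hy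

/-! ### The indicial equation. -/

/-- The indicial equation: a nonzero solution has a nonzero derivative at the origin whose order
is a root of `n (n - 1) = 2 λ`. -/
theorem RadialSolution.exists_indicial {m : ℤ} {lam : ℝ} {w : ℝ → ℂ}
    (h : RadialSolution m lam w) (hw : w ≠ 0) :
    ∃ n : ℕ, iteratedDeriv n w 0 ≠ 0 ∧ (n : ℝ) * (n - 1) = 2 * lam := by
  by_contra! hcon
  refine hw (h.eq_zero_of_flat fun n => ?_)
  have hs := h.1
  have hs'' := contDiff_infty_deriv (contDiff_infty_deriv hs)
  have hq : ContDiff ℝ ∞ fun y : ℝ => (y : ℂ) ^ 2 * w y := (contDiff_infty_ofReal.pow 2).mul hs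
  have hmw : ContDiff ℝ ∞ fun y : ℝ => (m : ℂ) * w y := contDiff_const.mul hs
  have hg := (hs''.sub hq).add hmw
  -- With all other terms moved under the factor `y²`, the `n`-th derivative at 0 reads `n(n-1)(w''
  -- - y² w + m w)^(n-2)(0) = 2λ w^(n)(0)`. Once the lower derivatives of `w` vanish, only `w''`
  -- contributes on the left.
  have heq : (fun y : ℝ => (y : ℂ) ^ 2 * (deriv (deriv w) y - (y : ℂ) ^ 2 * w y + m * w y))
      = fun y => 2 * (lam : ℂ) * w y := by
    funext y
    linear_combination h.2 y
  induction n using Nat.strong_induction_on with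
  | _ n ih =>
    by_contra hn
    refine hcon n hn ?_
    have hle : ((n : ℕ) : WithTop ℕ∞) ≤ ∞ := by exact_mod_cast le_top
    have hr : iteratedDeriv n (fun y => 2 * (lam : ℂ) * w y) 0
        = 2 * lam * iteratedDeriv n w 0 :=
      iteratedDeriv_const_mul _ (hs.of_le hle).contDiffAt
    rw [← heq] at hr
    have hc : (n : ℂ) * (n - 1) * iteratedDeriv n w 0 = 2 * lam * iteratedDeriv n w 0 := by
      rw [← hr]
      rcases n with _ | _ | n
      · simp
      · rw [iteratedDeriv_one_ofReal_sq_mul_zero hg]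
        simp
      · have hle' : ((n : ℕ) : WithTop ℕ∞) ≤ ∞ := by exact_mod_cast le_top
        have hz : iteratedDeriv n (fun y : ℝ => (y : ℂ) ^ 2 * w y) 0 = 0 := by
          rcases n with _ | _ | n
          · simp
          · exact iteratedDeriv_one_ofReal_sq_mul_zero hs
          · rw [iteratedDeriv_add_two_ofReal_sq_mul_zero n hs, ih n (by omega), mul_zero]
        rw [iteratedDeriv_add_two_ofReal_sq_mul_zero n hg,
          iteratedDeriv_fun_add ((hs''.sub hq).of_le hle').contDiffAt (hmw.of_le hle').contDiffAt,
          iteratedDeriv_fun_sub (hs''.of_le hle').contDiffAt (hq.of_le hle').contDiffAt, hz,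
          iteratedDeriv_const_mul _ (hs.of_le hle').contDiffAt, ih n (by omega),
          ← iteratedDeriv_succ', ← iteratedDeriv_succ']
        push_cast
        ring
    have hc' := mul_right_cancel₀ hn hc
    exact_mod_cast hc'

/-! ### Entire power series and Kummer's equation. -/

theorem summable_of_norm_le_pow_div_factorial {c : ℕ → ℂ} {A K : ℝ}
    (hc : ∀ n, ‖c n‖ ≤ A * (K ^ n / n !)) (z : ℂ) : Summable fun n => c n * z ^ n := by
  refine Summable.of_norm_bounded
    ((Real.summable_pow_div_factorial (K * ‖z‖)).mul_left A) fun n => ?_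
  rw [norm_mul, norm_pow]
  refine (mul_le_mul_of_nonneg_right (hc n) (by positivity)).trans (le_of_eq ?_)
  rw [mul_pow]
  ring

/-- The differentiated series satisfies a bound of the same shape, with `A * K` in place of `A`, so
termwise differentiation can be repeated. -/
theorem norm_succ_mul_le {c : ℕ → ℂ} {A K : ℝ} (hc : ∀ n, ‖c n‖ ≤ A * (K ^ n / n !)) (n : ℕ) :
    ‖((n : ℂ) + 1) * c (n + 1)‖ ≤ A * K * (K ^ n / n !) := by
  have h1 : ‖(n : ℂ) + 1‖ = n + 1 := by
    rw [← Nat.cast_succ, Complex.norm_natCast, Nat.cast_succ]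
  rw [norm_mul, h1]
  refine (mul_le_mul_of_nonneg_left (hc (n + 1)) (by positivity)).trans (le_of_eq ?_)
  rw [Nat.factorial_succ, pow_succ]
  push_cast
  field_simp

/-- Termwise multiplication of a power series by the Euler operator. -/
theorem hasSum_natCast_mul_pow {c : ℕ → ℂ} {A K : ℝ} (hc : ∀ n, ‖c n‖ ≤ A * (K ^ n / n !))
    (z : ℂ) :
    HasSum (fun n : ℕ => (n : ℂ) * c n * z ^ n)
      (z * ∑' n : ℕ, ((n : ℂ) + 1) * c (n + 1) * z ^ n) := by
  have hs := (summable_of_norm_le_pow_div_factorial (norm_succ_mul_le hc) z).hasSum.mul_left z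
  rw [← hasSum_nat_add_iff' 1]
  simp only [Finset.range_one, Finset.sum_singleton, Nat.cast_zero, zero_mul, sub_zero]
  have h : (fun n : ℕ => z * (((n : ℂ) + 1) * c (n + 1) * z ^ n))
      = fun n : ℕ => ((n + 1 : ℕ) : ℂ) * c (n + 1) * z ^ (n + 1) := by
    funext n
    push_cast
    ring
  rwa [h] at hs

/-- On the ball of radius `‖z‖ + 1` the differentiated terms are dominated by a summable
exponential-type series. -/
theorem hasDerivAt_tsum_mul_pow {c : ℕ → ℂ} {A K : ℝ} (hK : 0 ≤ K)
    (hc : ∀ n, ‖c n‖ ≤ A * (K ^ n / n !)) (z : ℂ) :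
    HasDerivAt (fun z : ℂ => ∑' n : ℕ, c n * z ^ n)
      (∑' n : ℕ, ((n : ℂ) + 1) * c (n + 1) * z ^ n) z := by
  set R : ℝ := ‖z‖ + 1
  have hz : z ∈ Metric.ball (0 : ℂ) R := by simp [R]
  have hR : 0 ≤ R := by positivity
  have hA : 0 ≤ A := by simpa using (norm_nonneg _).trans (hc 0)
  have hu : Summable fun n : ℕ => A * (K ^ n / n !) * (n * R ^ (n - 1)) := by
    rw [← summable_nat_add_iff 1]
    refine ((Real.summable_pow_div_factorial (K * R)).mul_left (A * K)).congr fun n => ?_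
    rw [Nat.factorial_succ, pow_succ, mul_pow]
    push_cast
    field_simp
  have h := hasDerivAt_tsum_of_isPreconnected (𝕜 := ℂ) (g := fun n z => c n * z ^ n)
    (g' := fun n z => c n * (n * z ^ (n - 1))) hu Metric.isOpen_ball
    (convex_ball (0 : ℂ) R).isPreconnected (fun n y _ => (hasDerivAt_pow n y).const_mul (c n))
    (fun n y hy => ?_) hz (summable_of_norm_le_pow_div_factorial hc z) hz
  · refine h.congr_deriv ?_
    have hsum : Summable fun n : ℕ => c (n + 1) * (((n + 1 : ℕ) : ℂ) * z ^ (n + 1 - 1)) := by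
      refine (summable_of_norm_le_pow_div_factorial (norm_succ_mul_le hc) z).congr fun n => ?_
      simp only [Nat.add_sub_cancel]
      push_cast
      ring
    rw [((summable_nat_add_iff (f := fun n : ℕ => c n * ((n : ℂ) * z ^ (n - 1))) 1).1
      hsum).tsum_eq_zero_add]
    simp only [Nat.cast_zero, zero_mul, mul_zero, zero_add, Nat.add_sub_cancel]
    refine tsum_congr fun n => ?_
    push_cast
    ring
  · rw [norm_mul, norm_mul, norm_pow, Complex.norm_natCast]
    have hy' : ‖y‖ ≤ R := by simpa using (Metric.mem_ball.1 hy).le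
    have := hc n
    gcongr

/-- The coefficients of `₁F₁(a,b,z)`. -/
noncomputable def hyp1F1Coeff (a b : ℂ) (n : ℕ) : ℂ :=
  (ascPochhammer ℂ n).eval a / (ascPochhammer ℂ n).eval b / (n ! : ℂ)

theorem hyp1F1_eq_tsum (a b z : ℂ) : hyp1F1 a b z = ∑' n, hyp1F1Coeff a b n * z ^ n :=
  tsum_congr fun n => by rw [hyp1F1Coeff]; ring

theorem hyp1F1Coeff_succ (a : ℂ) {b : ℂ} (hb : ∀ n : ℕ, b + n ≠ 0) (n : ℕ) :
    (n + 1) * (b + n) * hyp1F1Coeff a b (n + 1) = (a + n) * hyp1F1Coeff a b n := by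
  have hn : ((n : ℂ) + 1) ≠ 0 := by exact_mod_cast n.succ_ne_zero
  have hf : (n ! : ℂ) ≠ 0 := by exact_mod_cast n.factorial_ne_zero
  have hbn := hb n
  simp only [hyp1F1Coeff, ascPochhammer_succ_eval, Nat.factorial_succ]
  push_cast
  by_cases h0 : (ascPochhammer ℂ n).eval b = 0
  · simp [h0]
  · field_simp

/-- Since `|l + 1/2 + n| ≥ n + 1/2`, the ratio `|a + n| / |l + 1/2 + n|` is at most `2|a| + 1`; the
recurrence supplies the remaining factor `1/(n+1)`. -/
theorem norm_hyp1F1Coeff_le (a : ℂ) (l n : ℕ) :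
    ‖hyp1F1Coeff a ((l : ℂ) + 1 / 2) n‖ ≤ 1 * ((2 * ‖a‖ + 1) ^ n / n !) := by
  have hre : ∀ n : ℕ, (n : ℝ) + 1 / 2 ≤ ‖(l : ℂ) + 1 / 2 + n‖ := fun n => by
    refine le_trans ?_ (Complex.re_le_norm _)
    have : (0 : ℝ) ≤ l := l.cast_nonneg
    simp
    linarith
  have hb : ∀ n : ℕ, (l : ℂ) + 1 / 2 + n ≠ 0 := fun n h => by
    have := hre n
    rw [h, norm_zero] at this
    have : (0 : ℝ) ≤ n := n.cast_nonneg
    linarith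
  induction n with
  | zero => simp [hyp1F1Coeff]
  | succ n ih =>
    have h1 := congrArg norm (hyp1F1Coeff_succ a hb n)
    have hn1 : ‖(n : ℂ) + 1‖ = n + 1 := by
      rw [← Nat.cast_succ, Complex.norm_natCast, Nat.cast_succ]
    rw [norm_mul, norm_mul, norm_mul, hn1] at h1
    set x := ‖hyp1F1Coeff a ((l : ℂ) + 1 / 2) (n + 1)‖
    have hx : 0 ≤ x := norm_nonneg _
    have hn : (0 : ℝ) < n + 1 / 2 := by positivity
    have h2 : ‖a + n‖ ≤ (2 * ‖a‖ + 1) * (n + 1 / 2) := by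
      refine (norm_add_le _ _).trans ?_
      rw [Complex.norm_natCast]
      have := mul_nonneg (norm_nonneg a) n.cast_nonneg (α := ℝ)
      linarith
    have h3 : (n + 1) * x * (n + 1 / 2)
        ≤ (2 * ‖a‖ + 1) * (1 * ((2 * ‖a‖ + 1) ^ n / n !)) * (n + 1 / 2) := by
      calc (n + 1) * x * (n + 1 / 2) ≤ (n + 1) * x * ‖(l : ℂ) + 1 / 2 + n‖ := by
            gcongr; exact hre n
        _ = ‖a + n‖ * ‖hyp1F1Coeff a ((l : ℂ) + 1 / 2) n‖ := by rw [← h1]; ring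
        _ ≤ ((2 * ‖a‖ + 1) * (n + 1 / 2)) * (1 * ((2 * ‖a‖ + 1) ^ n / n !)) := by gcongr
        _ = _ := by ring
    have h4 := le_of_mul_le_mul_right h3 hn
    have h5 : x ≤ (2 * ‖a‖ + 1) * (1 * ((2 * ‖a‖ + 1) ^ n / n !)) / (n + 1) := by
      rw [le_div_iff₀ (by positivity)]; linarith
    refine h5.trans (le_of_eq ?_)
    rw [Nat.factorial_succ, pow_succ]
    push_cast
    field_simp

/-- Kummer's equation for `₁F₁(a,l+1/2,z)`, together with the derivatives that it involves. -/
theorem exists_hyp1F1_kummer (a : ℂ) (l : ℕ) :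
    ∃ H₁ H₂ : ℂ → ℂ, (∀ z, HasDerivAt (hyp1F1 a ((l : ℂ) + 1 / 2)) (H₁ z) z) ∧
      (∀ z, HasDerivAt H₁ (H₂ z) z) ∧
      ∀ z, z * H₂ z + ((l : ℂ) + 1 / 2 - z) * H₁ z - a * hyp1F1 a ((l : ℂ) + 1 / 2) z = 0 := by
  have hK : 0 ≤ 2 * ‖a‖ + 1 := by positivity
  have hc := norm_hyp1F1Coeff_le a l
  have hc1 := norm_succ_mul_le hc
  set b : ℂ := (l : ℂ) + 1 / 2 with hbdef
  have hb : ∀ n : ℕ, b + n ≠ 0 := fun n h => by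
    have h := congrArg Complex.re h
    simp [hbdef] at h
    have h1 : (0 : ℝ) ≤ n := n.cast_nonneg
    have h2 : (0 : ℝ) ≤ l := l.cast_nonneg
    linarith
  have hH : hyp1F1 a b = fun z => ∑' n, hyp1F1Coeff a b n * z ^ n :=
    funext fun z => hyp1F1_eq_tsum a b z
  refine ⟨_, _, fun z => by rw [hH]; exact hasDerivAt_tsum_mul_pow hK hc z,
    fun z => hasDerivAt_tsum_mul_pow hK hc1 z, fun z => ?_⟩
  rw [hH]
  have s0 := (summable_of_norm_le_pow_div_factorial hc z).hasSum.mul_left a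
  have s1 := (summable_of_norm_le_pow_div_factorial hc1 z).hasSum.mul_left b
  have s2 := hasSum_natCast_mul_pow hc z
  have s3 := hasSum_natCast_mul_pow hc1 z
  -- The coefficient of `z^n` is `(n+1)(b+n) c_(n+1) - (a+n) c_n`, which the recurrence makes zero.
  have s := ((s3.add s1).sub s2).sub s0
  have h0 := s.tsum_eq.symm.trans
    ((tsum_congr fun n => by linear_combination z ^ n * hyp1F1Coeff_succ a hb n).trans tsum_zero)
  linear_combination h0

theorem hyp1F1_zero (a b : ℂ) : hyp1F1 a b 0 = 1 := by
  rw [hyp1F1, tsum_eq_single 0 fun n hn => by simp [hn]]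
  simp

/-! ### The explicit solution. -/

/-- The radial part `e^{-z²/2} z^l ₁F₁((1+2l-m)/4, l+1/2, z²)` on the complex plane. -/
noncomputable def kTypeRadial (m : ℤ) (l : ℕ) (z : ℂ) : ℂ :=
  Complex.exp (-(z ^ 2 / 2)) * z ^ l *
    hyp1F1 ((1 + 2 * (l : ℂ) - m) / 4) ((l : ℂ) + 1 / 2) (z ^ 2)

theorem kTypeVector_eq (m : ℤ) (l : ℕ) :
    kTypeVector m l = fun (θ y : ℝ) =>
      Complex.exp (-(Complex.I * m * θ / 2)) * kTypeRadial m l y := by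
  funext θ y
  rw [kTypeVector, kTypeRadial]
  ring

theorem kTypeRadial_neg (m : ℤ) (l : ℕ) (z : ℂ) :
    kTypeRadial m l (-z) = (-1) ^ l * kTypeRadial m l z := by
  rw [kTypeRadial, kTypeRadial, neg_sq, neg_pow z l]
  ring

theorem radialSolution_kTypeRadial (m : ℤ) (l : ℕ) {lam : ℝ}
    (hl : (l : ℝ) * (l - 1) = 2 * lam) : RadialSolution m lam fun y : ℝ => kTypeRadial m l y := by
  obtain ⟨H₁, H₂, hH, hH₁, hode⟩ := exists_hyp1F1_kummer ((1 + 2 * (l : ℂ) - m) / 4) l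
  set H := hyp1F1 ((1 + 2 * (l : ℂ) - m) / 4) ((l : ℂ) + 1 / 2) with hHdef
  have hsq : ∀ z : ℂ, HasDerivAt (fun z : ℂ => z ^ 2) (2 * z) z := fun z => by
    simpa using hasDerivAt_pow 2 z
  have hexp : ∀ z : ℂ, HasDerivAt (fun z : ℂ => Complex.exp (-(z ^ 2 / 2)))
      (Complex.exp (-(z ^ 2 / 2)) * -z) z := fun z => by
    refine ((hsq z).div_const 2).fun_neg.cexp.congr_deriv ?_
    ring
  have hHs : ∀ z, HasDerivAt (fun z => H (z ^ 2)) (H₁ (z ^ 2) * (2 * z)) z := fun z =>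
    HasDerivAt.comp (h₂ := H) z (hH (z ^ 2)) (hsq z)
  have hH₁s : ∀ z, HasDerivAt (fun z => H₁ (z ^ 2)) (H₂ (z ^ 2) * (2 * z)) z := fun z =>
    HasDerivAt.comp (h₂ := H₁) z (hH₁ (z ^ 2)) (hsq z)
  have hP : ∀ z : ℂ, HasDerivAt (fun z : ℂ => z ^ l) (l * z ^ (l - 1)) z := hasDerivAt_pow l
  have hP₁ : ∀ z : ℂ, HasDerivAt (fun z : ℂ => (l : ℂ) * z ^ (l - 1))
      (l * (((l - 1 : ℕ) : ℂ) * z ^ (l - 1 - 1))) z := fun z =>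
    (hasDerivAt_pow (l - 1) z).const_mul (l : ℂ)
  -- Multiplying the derivatives of `z^l` by `z` and `z²` clears the truncated exponents; for `l =
  -- 0, 1` the numerical factors vanish.
  have eP₁ : ∀ z : ℂ, z * (l * z ^ (l - 1)) = l * z ^ l := fun z => by
    rcases l with _ | l
    · simp
    · simp [pow_succ]; ring
  have eP₂ : ∀ z : ℂ, z ^ 2 * (l * (((l - 1 : ℕ) : ℂ) * z ^ (l - 1 - 1)))
      = l * (l - 1) * z ^ l := fun z => by
    rcases l with _ | _ | l
    · simp
    · simp
    · simp only [Nat.add_sub_cancel]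
      push_cast
      ring
  have hd := fun z => ((hexp z).fun_mul (hP z)).fun_mul (hHs z)
  have hdd := fun z => ((((hexp z).fun_mul (hasDerivAt_id z).fun_neg).fun_mul (hP z)).fun_add
    ((hexp z).fun_mul (hP₁ z))).fun_mul (hHs z) |>.fun_add
    (((hexp z).fun_mul (hP z)).fun_mul ((hH₁s z).fun_mul ((hasDerivAt_id z).const_mul 2)))
  have hd1 : deriv (fun y : ℝ => kTypeRadial m l y) = _ := funext fun y =>
    ((hd (y : ℂ)).comp_ofReal).deriv
  refine ⟨?_, fun y => ?_⟩
  · have hdiff : Differentiable ℂ (kTypeRadial m l) := fun z => (hd z).differentiableAt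
    exact (hdiff.contDiff.restrict_scalars ℝ).comp contDiff_infty_ofReal
  · rw [hd1]
    have hd2 := ((hdd (y : ℂ)).comp_ofReal).deriv
    simp only [id] at hd2
    rw [hd2]
    simp only [kTypeRadial, ← hHdef]
    have hlc : (l : ℂ) * (l - 1) = 2 * lam := by exact_mod_cast hl
    have e1 := eP₁ y
    have e2 := eP₂ y
    have e3 := hode ((y : ℂ) ^ 2)
    -- With the transcendental factors made atoms, the claim is a polynomial consequence of the
    -- power rules, Kummer's equation at `y²` and `l(l-1) = 2λ`.
    generalize (l : ℂ) * (y : ℂ) ^ (l - 1) = P₁ at *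
    generalize (l : ℂ) * (((l - 1 : ℕ) : ℂ) * (y : ℂ) ^ (l - 1 - 1)) = P₂ at *
    generalize (y : ℂ) ^ l = P at *
    generalize Complex.exp (-((y : ℂ) ^ 2 / 2)) = E at *
    generalize H ((y : ℂ) ^ 2) = h at *
    generalize H₁ ((y : ℂ) ^ 2) = h₁ at *
    generalize H₂ ((y : ℂ) ^ 2) = h₂ at *
    linear_combination E * h * e2 + 2 * y * E * (2 * y * h₁ - y * h) * e1
      + 4 * y ^ 2 * E * P * e3 + E * h * P * hlc

theorem exists_kTypeRadial_ne_zero (m : ℤ) (l : ℕ) : ∃ y : ℝ, kTypeRadial m l y ≠ 0 := by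
  by_contra! h
  obtain ⟨H₁, H₂, hH, -, -⟩ := exists_hyp1F1_kummer ((1 + 2 * (l : ℂ) - m) / 4) l
  have hc : Continuous fun y : ℝ =>
      hyp1F1 ((1 + 2 * (l : ℂ) - m) / 4) ((l : ℂ) + 1 / 2) ((y : ℂ) ^ 2) := by
    have : Differentiable ℂ (hyp1F1 ((1 + 2 * (l : ℂ) - m) / 4) ((l : ℂ) + 1 / 2)) :=
      fun z => (hH z).differentiableAt
    exact this.continuous.comp (Complex.continuous_ofReal.pow 2)
  -- The factor `y^l` may vanish at 0, so the hypergeometric factor is shown to be zero off the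
  -- origin and, by continuity, at it, where its value is 1.
  have hz := hc.ext_on (dense_compl_singleton (0 : ℝ)) continuous_const (g := fun _ => (0 : ℂ))
    fun y hy => by
      have hy' : (y : ℂ) ≠ 0 := by simpa using hy
      have := h y
      rw [kTypeRadial] at this
      simpa [hy'] using this
  simpa [hyp1F1_zero] using congrFun hz 0

/-! ### Weight vectors and the radial equation. -/

theorem exp_half_pi_int (n : ℤ) :
    Complex.exp (Complex.I * n * Real.pi / 2) = Complex.I ^ n := by
  rw [show Complex.I * n * Real.pi / 2 = n * (Real.pi / 2 * Complex.I) by ring,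
    Complex.exp_int_mul, Complex.exp_pi_div_two_mul_I]

/-- The function on the plane with weight `m` and given restriction to `θ = 0`. -/
noncomputable def weightExtension (m : ℤ) (w : ℝ → ℂ) : ℝ → ℝ → ℂ := fun θ y =>
  Complex.exp (-(Complex.I * m * θ / 2)) * w y

theorem weightExtension_smul (m : ℤ) (c : ℂ) (w : ℝ → ℂ) :
    weightExtension m (c • w) = c • weightExtension m w := by
  funext θ y
  simp only [weightExtension, Pi.smul_apply, smul_eq_mul]
  ring

theorem IsWeightVector.eq_weightExtension {m : ℤ} {F : ℝ → ℝ → ℂ} (h : IsWeightVector m F) :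
    F = weightExtension m (F 0) := by
  funext θ y
  have := h.2 θ θ y
  rw [rotate, sub_self] at this
  rw [weightExtension, this, ← mul_assoc, ← Complex.exp_add, neg_add_cancel, Complex.exp_zero,
    one_mul]

theorem isWeightVector_weightExtension (m : ℤ) {w : ℝ → ℂ} (hw : w ≠ 0) :
    IsWeightVector m (weightExtension m w) := by
  refine ⟨fun h => hw (funext fun y => ?_), fun α θ y => ?_⟩
  · simpa [weightExtension] using congrFun (congrFun h 0) y
  · rw [rotate, weightExtension, weightExtension, ← mul_assoc, ← Complex.exp_add]
    congr 2
    push_cast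
    ring

theorem IsWeightVector.isKFinite {m : ℤ} {F : ℝ → ℝ → ℂ} (h : IsWeightVector m F) :
    IsKFinite F := by
  have hle : Submodule.span ℂ (Set.range fun α : ℝ => rotate α F) ≤ Submodule.span ℂ {F} := by
    refine Submodule.span_le.2 ?_
    rintro _ ⟨α, rfl⟩
    refine Submodule.mem_span_singleton.2 ⟨Complex.exp (Complex.I * m * α / 2), ?_⟩
    funext θ y
    exact (h.2 α θ y).symm
  exact Submodule.finiteDimensional_of_le hle

theorem isSmooth_weightExtension (m : ℤ) {w : ℝ → ℂ} (hw : ContDiff ℝ ∞ w) :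
    IsSmooth (weightExtension m w) := by
  have h1 : ContDiff ℝ ∞ fun p : ℝ × ℝ => (p.1 : ℂ) := contDiff_infty_ofReal.comp contDiff_fst
  exact (((contDiff_const.mul h1).div_const 2).neg.cexp).mul (hw.comp contDiff_snd)

theorem casimirCompact_weightExtension (m : ℤ) (w : ℝ → ℂ) (θ y : ℝ) :
    casimirCompact (weightExtension m w) θ y =
      Complex.exp (-(Complex.I * m * θ / 2)) *
        ((y : ℂ) ^ 2 * (m * w y - (y : ℂ) ^ 2 * w y + deriv (deriv w) y)) := by
  have h1 : dFst (weightExtension m w) θ y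
      = Complex.exp (-(Complex.I * m * θ / 2)) * (-(Complex.I * m / 2)) * w y := by
    refine HasDerivAt.deriv ?_
    refine ((((hasDerivAt_ofReal θ).const_mul (Complex.I * m)).div_const
      2).fun_neg.cexp.mul_const (w y)).congr_deriv ?_
    ring
  have h2 : dSnd (dSnd (weightExtension m w)) θ y
      = Complex.exp (-(Complex.I * m * θ / 2)) * deriv (deriv w) y := by
    have : dSnd (weightExtension m w) θ
        = fun y => Complex.exp (-(Complex.I * m * θ / 2)) * deriv w y := by
      funext y
      exact deriv_const_mul_field _
    rw [dSnd, this]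
    exact deriv_const_mul_field _
  rw [casimirCompact, h1, h2, weightExtension]
  linear_combination -(y : ℂ) ^ 2 * m * w y * Complex.exp (-(Complex.I * m * θ / 2)) *
    Complex.I_sq

/-- Weight vectors in the kernel of the Casimir operator correspond to smooth solutions of the
radial equation of the right parity. -/
theorem weightExtension_mem_casimirKernel_iff {q m : ℤ} {lam : ℝ} {w : ℝ → ℂ} :
    weightExtension m w ∈ casimirKernel q lam ↔
      RadialSolution m lam w ∧ ∀ y, w (-y) = Complex.I ^ (m - q) * w y := by
  constructor
  · rintro ⟨⟨hs, hp⟩, hk⟩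
    have hI : ∀ n : ℤ, Complex.I ^ n ≠ 0 := fun n => zpow_ne_zero n Complex.I_ne_zero
    refine ⟨⟨?_, fun y => ?_⟩, fun y => ?_⟩
    · have h : ContDiff ℝ ∞ fun y : ℝ => Function.uncurry (weightExtension m w) (0, y) :=
        ContDiff.comp hs (contDiff_const.prodMk contDiff_id)
      simpa [weightExtension] using h
    · have := hk 0 y
      rw [casimirCompact_weightExtension, weightExtension] at this
      simp only [Complex.ofReal_zero, mul_zero, zero_div, neg_zero, Complex.exp_zero,
        one_mul] at this
      linear_combination this
    -- The parity is the equivariance under the generator `j = 1`, read at `θ = 0`.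
    · have := hp 1 0 y
      simp only [weightExtension, Int.cast_one, zero_add, one_mul, zpow_one, neg_mul,
        Complex.ofReal_zero, mul_zero, zero_div, neg_zero, Complex.exp_zero] at this
      rw [Complex.exp_neg, exp_half_pi_int, inv_mul_eq_iff_eq_mul₀ (hI m)] at this
      rw [this, ← mul_assoc, ← zpow_add₀ Complex.I_ne_zero, sub_eq_add_neg]
  · rintro ⟨hr, hp⟩
    refine ⟨⟨isSmooth_weightExtension m hr.1, fun j θ y => ?_⟩, fun θ y => ?_⟩
    · have hj : w ((-1 : ℝ) ^ j * y) = Complex.I ^ (j * (m - q)) * w y := by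
        induction j using Int.induction_on with
        | zero => simp
        | succ j ih =>
          rw [zpow_add_one₀ (by norm_num), mul_neg_one, neg_mul, hp, ih, ← mul_assoc,
            ← zpow_add₀ Complex.I_ne_zero]
          congr 2
          ring
        | pred j ih =>
          refine mul_left_cancel₀ (zpow_ne_zero (m - q) Complex.I_ne_zero) ?_
          rw [← hp, ← neg_mul, ← mul_neg_one, ← zpow_add_one₀ (by norm_num), sub_add_cancel, ih,
            ← mul_assoc, ← zpow_add₀ Complex.I_ne_zero]
          congr 2
          ring
      rw [weightExtension, weightExtension, hj]
      have he : Complex.exp (-(Complex.I * m * ((θ + j * Real.pi : ℝ) : ℂ) / 2))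
          = Complex.exp (-(Complex.I * m * θ / 2)) * Complex.I ^ (-(j * m)) := by
        rw [← exp_half_pi_int, ← Complex.exp_add]
        congr 1
        push_cast
        ring
      rw [he, show -(j * q) = -(j * m) + j * (m - q) by ring, zpow_add₀ Complex.I_ne_zero]
      ring
    · rw [casimirCompact_weightExtension, weightExtension]
      linear_combination Complex.exp (-(Complex.I * m * θ / 2)) * hr.2 y

/-- Write `-1 = i²` and use that `i` has order 4. -/
theorem neg_one_pow_eq_I_zpow_iff {q m : ℤ} {n : ℕ} :
    (-1 : ℂ) ^ n = Complex.I ^ (m - q) ↔ m ≡ 2 * n + q [ZMOD 4] := by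
  have h : (-1 : ℂ) ^ n = Complex.I ^ (2 * (n : ℤ)) := by
    rw [zpow_mul, zpow_natCast]
    norm_num [zpow_ofNat]
  rw [h, eq_comm, ← div_eq_one_iff_eq (zpow_ne_zero _ Complex.I_ne_zero),
    ← zpow_sub₀ Complex.I_ne_zero, Complex.isPrimitiveRoot_I.zpow_eq_one_iff_dvd, Int.modEq_comm,
    Int.modEq_iff_dvd, sub_sub, add_comm q]
  rfl

/-- The possible leading exponents of a weight vector in the kernel of the Casimir operator. -/
theorem exists_indicial_of_mem_casimirKernel {q m : ℤ} {lam : ℝ} {F : ℝ → ℝ → ℂ}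
    (hF : F ∈ casimirKernel q lam) (hm : IsWeightVector m F) :
    ∃ n : ℕ, (n : ℝ) * (n - 1) = 2 * lam ∧ m ≡ 2 * n + q [ZMOD 4] := by
  have hE := hm.eq_weightExtension
  rw [hE, weightExtension_mem_casimirKernel_iff] at hF
  have hw : F 0 ≠ 0 := fun h => hm.1 (by rw [hE, h]; funext θ y; simp [weightExtension])
  obtain ⟨n, hn, hind⟩ := hF.1.exists_indicial hw
  refine ⟨n, hind, neg_one_pow_eq_I_zpow_iff.1 ?_⟩
  -- Differentiating the parity relation `n` times at 0 and cancelling the nonzero derivative leaves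
  -- `(-1)^n = i^(m-q)`.
  have h1 := iteratedDeriv_comp_neg n (F 0) 0
  have hle : ((n : ℕ) : WithTop ℕ∞) ≤ ∞ := by exact_mod_cast le_top
  rw [funext hF.2, iteratedDeriv_const_mul _ (hF.1.1.of_le hle).contDiffAt, neg_zero,
    Complex.real_smul] at h1
  have h2 := mul_right_cancel₀ hn h1
  rw [h2]
  push_cast
  rfl

theorem kTypeVector_mem_casimirKernel {q m : ℤ} {lam : ℝ} {l : ℕ}
    (hl : (l : ℝ) * (l - 1) = 2 * lam) (hm : m ≡ 2 * l + q [ZMOD 4]) :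
    kTypeVector m l ∈ casimirKernel q lam := by
  rw [kTypeVector_eq]
  refine weightExtension_mem_casimirKernel_iff.2 ⟨radialSolution_kTypeRadial m l hl, fun y => ?_⟩
  rw [Complex.ofReal_neg, kTypeRadial_neg, neg_one_pow_eq_I_zpow_iff.2 hm]

theorem isWeightVector_kTypeVector (m : ℤ) (l : ℕ) : IsWeightVector m (kTypeVector m l) := by
  rw [kTypeVector_eq]
  refine isWeightVector_weightExtension m (w := fun y : ℝ => kTypeRadial m l y) fun h => ?_
  obtain ⟨y, hy⟩ := exists_kTypeRadial_ne_zero m l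
  exact hy (congrFun h y)

/-- Uniform in `λ`: the cases `λ ≠ 0` and `λ = 0` differ only in the natural roots of the indicial
equation. -/
theorem exists_weightVector_iff (q m : ℤ) (lam : ℝ) :
    (∃ F ∈ casimirKernel q lam, IsKFinite F ∧ IsWeightVector m F) ↔
      ∃ l : ℕ, (l : ℝ) * (l - 1) = 2 * lam ∧ m ≡ 2 * l + q [ZMOD 4] := by
  constructor
  · rintro ⟨F, hF, -, hm⟩
    exact exists_indicial_of_mem_casimirKernel hF hm
  · rintro ⟨l, hl, hm⟩
    have h := isWeightVector_kTypeVector m l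
    exact ⟨_, kTypeVector_mem_casimirKernel hl hm, h.isKFinite, h⟩

/-! ### Uniqueness and the formula for the exponent. -/

theorem RadialSolution.sub_smul {m : ℤ} {lam : ℝ} {w v : ℝ → ℂ} (hw : RadialSolution m lam w)
    (hv : RadialSolution m lam v) (c : ℂ) : RadialSolution m lam (w - c • v) := by
  have d1 := contDiff_infty_differentiable hw.1
  have d2 := contDiff_infty_differentiable hv.1
  have d1' := contDiff_infty_differentiable (contDiff_infty_deriv hw.1)
  have d2' := contDiff_infty_differentiable (contDiff_infty_deriv hv.1)
  refine ⟨hw.1.sub (hv.1.const_smul c), fun y => ?_⟩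
  have e1 : deriv (w - c • v) = deriv w - c • deriv v :=
    funext fun y => ((d1 y).hasDerivAt.sub ((d2 y).hasDerivAt.const_smul c)).deriv
  rw [e1, ((d1' y).hasDerivAt.sub ((d2' y).hasDerivAt.const_smul c)).deriv]
  simp only [Pi.sub_apply, Pi.smul_apply, smul_eq_mul]
  linear_combination hw.2 y - c * hv.2 y

/-- If the indicial equation has a single root in the natural numbers, then the space of smooth
solutions of the radial equation has dimension at most one. -/
theorem RadialSolution.exists_eq_smul {m : ℤ} {lam : ℝ} {w v : ℝ → ℂ} {l : ℕ}
    (hl : ∀ n : ℕ, (n : ℝ) * (n - 1) = 2 * lam → n = l) (hw : RadialSolution m lam w)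
    (hv : RadialSolution m lam v) (hv0 : v ≠ 0) : ∃ c : ℂ, w = c • v := by
  obtain ⟨n, hn, hind⟩ := hv.exists_indicial hv0
  obtain rfl := hl n hind
  -- This choice kills the `n`-th derivative of `w - c v` at 0, the only one that could witness a
  -- nonzero solution.
  set c := iteratedDeriv n w 0 / iteratedDeriv n v 0 with hc
  refine ⟨c, ?_⟩
  by_contra hne
  obtain ⟨k, hk, hind'⟩ := (hw.sub_smul hv c).exists_indicial (sub_ne_zero.2 hne)
  obtain rfl := hl k hind'
  have hle : ((k : ℕ) : WithTop ℕ∞) ≤ ∞ := by exact_mod_cast le_top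
  have hvk := (hv.1.of_le hle).contDiffAt (x := 0)
  have hcv : ContDiffAt ℝ k (c • v) 0 := hvk.const_smul c
  rw [iteratedDeriv_sub (hw.1.of_le hle).contDiffAt hcv, iteratedDeriv_const_smul hvk,
    smul_eq_mul, hc, div_mul_cancel₀ _ hn, sub_self] at hk
  exact hk rfl

/-- Positivity of `l` gives `2l - 1 > 0`, which makes squaring reversible. It also excludes `l = 0`,
a root at `λ = 0` that the formula misses. -/
theorem natCast_eq_half_one_add_sqrt_iff {l : ℕ} (hl : 0 < l) (lam : ℝ) :
    (l : ℝ) = (1 + √(1 + 8 * lam)) / 2 ↔ (l : ℝ) * (l - 1) = 2 * lam := by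
  have h1 : (1 : ℝ) ≤ l := by exact_mod_cast hl
  have h2 : (l : ℝ) = (1 + √(1 + 8 * lam)) / 2 ↔ √(1 + 8 * lam) = 2 * l - 1 :=
    ⟨fun h => by linarith, fun h => by linarith⟩
  rw [h2, Real.sqrt_eq_iff_mul_self_eq_of_pos (by linarith)]
  exact ⟨fun h => by linarith, fun h => by linarith⟩

theorem eq_of_indicial {lam : ℝ} (hlam : lam ≠ 0) {n k : ℕ}
    (hn : (n : ℝ) * (n - 1) = 2 * lam) (hk : (k : ℝ) * (k - 1) = 2 * lam) : n = k := by
  have hpos : ∀ {j : ℕ}, (j : ℝ) * (j - 1) = 2 * lam → 0 < j := fun {j} h =>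
    Nat.pos_of_ne_zero fun h0 => hlam (by rw [h0] at h; simpa using h)
  have h1 := (natCast_eq_half_one_add_sqrt_iff (hpos hn) lam).2 hn
  have h2 := (natCast_eq_half_one_add_sqrt_iff (hpos hk) lam).2 hk
  exact_mod_cast h1.trans h2.symm

theorem mainTheorem3 (q m : ℤ) (lam : ℝ) :
    (lam ≠ 0 →
      ((∃ F ∈ casimirKernel q lam, IsKFinite F ∧ IsWeightVector m F) ↔
        ∃ l : ℕ, 0 < l ∧ (l : ℝ) = (1 + √(1 + 8 * lam)) / 2 ∧ m ≡ 2 * l + q [ZMOD 4])) ∧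
    (lam = 0 →
      ((∃ F ∈ casimirKernel q lam, IsKFinite F ∧ IsWeightVector m F) ↔
        ∃ l : ℕ, (l = 0 ∨ l = 1) ∧ m ≡ 2 * l + q [ZMOD 4])) ∧
    (∀ l : ℕ, 0 < l →
      ((l : ℝ) = (1 + √(1 + 8 * lam)) / 2 ↔ lam = (l : ℝ) * (l - 1) / 2)) ∧
    (lam ≠ 0 → ∀ l : ℕ, 0 < l → (l : ℝ) = (1 + √(1 + 8 * lam)) / 2 →
      m ≡ 2 * l + q [ZMOD 4] →
        kTypeVector m l ∈ casimirKernel q lam ∧ IsWeightVector m (kTypeVector m l) ∧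
        ∀ F ∈ casimirKernel q lam, IsWeightVector m F → ∃ c : ℂ, F = c • kTypeVector m l) := by
  refine ⟨fun hlam => ?_, fun hlam => ?_, fun l hl => ?_, fun hlam l hl hlq hm => ?_⟩
  · rw [exists_weightVector_iff]
    refine exists_congr fun l => ⟨fun h => ?_, fun h =>
      ⟨(natCast_eq_half_one_add_sqrt_iff h.1 lam).1 h.2.1, h.2.2⟩⟩
    have hl : 0 < l := Nat.pos_of_ne_zero fun h0 => hlam (by
      have := h.1
      rw [h0] at this
      simpa using this)
    exact ⟨hl, (natCast_eq_half_one_add_sqrt_iff hl lam).2 h.1, h.2⟩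
  · rw [exists_weightVector_iff]
    refine exists_congr fun l => and_congr_left fun _ => ?_
    rw [hlam, mul_zero, mul_eq_zero, sub_eq_zero, Nat.cast_eq_zero, Nat.cast_eq_one]
  · rw [natCast_eq_half_one_add_sqrt_iff hl]
    exact ⟨fun h => by linarith, fun h => by linarith⟩
  · have hind := (natCast_eq_half_one_add_sqrt_iff hl lam).1 hlq
    refine ⟨kTypeVector_mem_casimirKernel hind hm, isWeightVector_kTypeVector m l,
      fun F hF hFm => ?_⟩
    have hE := hFm.eq_weightExtension
    rw [hE, weightExtension_mem_casimirKernel_iff] at hF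
    have hv0 : (fun y : ℝ => kTypeRadial m l y) ≠ 0 := fun h => by
      obtain ⟨y, hy⟩ := exists_kTypeRadial_ne_zero m l
      exact hy (congrFun h y)
    obtain ⟨c, hc⟩ := hF.1.exists_eq_smul (fun n hn => eq_of_indicial hlam hn hind)
      (radialSolution_kTypeRadial m l hind) hv0
    refine ⟨c, ?_⟩
    rw [hE, hc, weightExtension_smul, kTypeVector_eq]
    rfl
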